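/- Let $\Gamma$ be a nonempty connected symmetric graph, i.e. a directed graph (possibly infinite, loops and multiple edges allowed; a labelling of the edges plays no role) whose edges occur in inverse pairs. For vertices $u,v\in V(\Gamma)$ let $d(u,v)$ be the least length of a path from $u$ to $v$; this makes $V(\Gamma)$ a metric space. For a vertex $z$ and a path $p$, let $d(z,p)$ be the minimum of $d(z,w)$ over the vertices $w$ of $p$; for $S\subseteq V(\Gamma)$ let $\operatorname{diam}(S)=\sup\{d(u,v):u,v\in S\}$; put $(x|y)_z=\tfrac12\bigl(d(z,x)+d(z,y)-d(x,y)\bigr)$ and $D_\delta(x)=\{y\in V(\Gamma): d(x,y)\le\delta\}$. The following conditions are equivalent: 1. $\Gamma$ is quasi-isometric to a tree: there are a tree $T$ (an undirected graph, whose vertex set is equipped with its path metric $d_T$), a map $\psi:V(\Gamma)\to V(T)$ and positive constants $k,c,K,C$ with $k\,d(x_1,x_2)-c\le d_T(\psi(x_1),\psi(x_2))\le K\,d(x_1,x_2)+C$ for all $x_1,x_2\in V(\Gamma)$, and a constant $m$ such that every $y\in V(T)$ satisfies $d_T(y,\psi(x))\le m$ for some $x\in V(\Gamma)$. 2. There exist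 a constant $m>1$ and a partition $\mathcal P$ of $V(\Gamma)$ with $\operatorname{diam}(S)\le m$ for every block $S\in\mathcal P$ which is a strong tree decomposition: the simple undirected graph with vertex set $\mathcal P$, in which two distinct blocks $S_1,S_2$ are adjacent if and only if some edge of $\Gamma$ joins a vertex of $S_1$ to a vertex of $S_2$, is a tree. 3. There exists a constant $m>1$ such that for all $x,y,z\in V(\Gamma)$ and every path $p$ from $x$ to $y$, $$d(z,p)\le \tfrac12\bigl(d(z,x)+d(z,y)-d(x,y)\bigr)+m.$$ 4. There exists a constant $k$ such that for all $n\ge1$ and all $x_0,\dots,x_n,z\in V(\Gamma)$, $$(x_0|x_n)_z\ge\min\{(x_0|x_1)_z,\dots,(x_{n-1}|x_n)_z\}-k.$$ 5. $\Gamma$ is polygon hyperbolic: there exists $\delta\ge0$ such that for every $n\ge2$ and every sequence of geodesic paths $p_1,\dots,p_n$ in $\Gamma$ (paths whose length is the distance between their endpoints) such that $p_{i+1}$ starts where $p_i$ ends for $1\le i\le n-1$ and $p_1$ starts where $p_n$ ends, each vertex $y$ of each $p_i$ satisfies $d(y,z)\le\delta$ for some vertex $z$ of some $p_j$ with $j\ne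 i$. 6. There exists a constant $\delta$ such that for all $x,x_0,y\in V(\Gamma)$ with $x_0\notin D_\delta(x)$ and $d(x_0,y)=d(x_0,x)+d(x,y)$, there is no path from $x_0$ to $y$ in $\Gamma$ all of whose vertices lie outside $D_\delta(x)$. -/

import Mathlib

/-! Symmetric graphs in the sense of Serre are modelled by quivers with an involutive reversal of
arrows: loops, multiple edges, infinite valency and infinite vertex sets are all allowed. -/

open scoped ENNReal

universe u v

namespace SymmGraph

/-- The map `ψ` is a quasi-isometry with respect to the distance functions `dX` and `dY`. -/
def IsQuasiIsometry {X Y : Type*} (dX : X → X → ℝ) (dY : Y → Y → ℝ) (ψ : X → Y) : Prop :=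
  (∃ k c K C : ℝ, 0 < k ∧ 0 < c ∧ 0 < K ∧ 0 < C ∧ ∀ x₁ x₂ : X,
    k * dX x₁ x₂ - c ≤ dY (ψ x₁) (ψ x₂) ∧ dY (ψ x₁) (ψ x₂) ≤ K * dX x₁ x₂ + C) ∧
  ∃ m : ℝ, ∀ y : Y, ∃ x : X, dY y (ψ x) ≤ m

section

variable {V : Type u} [Quiver.{v} V]

/-- The path distance: the least length of a path from `x` to `y`
(used for connected graphs only, where such paths exist). -/
noncomputable def dist (x y : V) : ℕ :=
  sInf {n : ℕ | ∃ p : Quiver.Path x y, p.length = n}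

/-- A path is geodesic if its length is the distance of its endpoints. -/
def IsGeodesic {x y : V} (p : Quiver.Path x y) : Prop :=
  p.length = dist x y

/-- The distance `d(z, p)` from a vertex to (the vertex set of) a path. -/
noncomputable def distToPath (z : V) {x y : V} (p : Quiver.Path x y) : ℕ :=
  sInf {n : ℕ | ∃ w ∈ p.vertices, dist z w = n}

/-- The Gromov product `(x|y)_z`. -/
noncomputable def gromovProduct (x y z : V) : ℝ :=
  1 / 2 * ((dist z x : ℝ) + (dist z y : ℝ) - (dist x y : ℝ))

/-- The diameter of a set of vertices, measured in the whole graph; `∞` if unbounded. -/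
noncomputable def diam (S : Set V) : ℝ≥0∞ :=
  ⨆ x ∈ S, ⨆ y ∈ S, (dist x y : ℝ≥0∞)

/-- The vertex set of the closed disk of center `x` and radius `r`. -/
def disk (r : ℝ) (x : V) : Set V :=
  {y | (dist x y : ℝ) ≤ r}

/-- The vertex set of the cone of `x` with respect to the basepoint `x₀`. -/
def cone (x₀ x : V) : Set V :=
  {y | dist x₀ y = dist x₀ x + dist x y}

variable (V) in
/-- A geodesic polygon: a closed cyclic sequence of `n ≥ 2` geodesic paths, consecutive ones
sharing an endpoint. Side `i` runs from corner `i` to corner `i + 1`. -/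
structure GeodesicPolygon where
  n : ℕ
  two_le : 2 ≤ n
  corner : Fin (n + 1) → V
  closed : corner (Fin.last n) = corner 0
  side : ∀ i : Fin n, Quiver.Path (corner i.castSucc) (corner i.succ)
  geodesic : ∀ i : Fin n, IsGeodesic (side i)

/-- Every vertex of every side is within `δ` of a vertex of some other side. -/
def GeodesicPolygon.IsThin (δ : ℝ) (G : GeodesicPolygon V) : Prop :=
  ∀ i : Fin G.n, ∀ y ∈ (G.side i).vertices,
    ∃ j : Fin G.n, j ≠ i ∧ ∃ z ∈ (G.side j).vertices, (dist y z : ℝ) ≤ δ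

variable (V) in
/-- Polygon hyperbolicity. -/
def IsPolygonHyperbolic : Prop :=
  ∃ δ : ℝ, 0 ≤ δ ∧ ∀ G : GeodesicPolygon V, G.IsThin δ

variable (V) in
/-- The graph is quasi-isometric to a tree (with its graph metric on vertices). -/
def IsTreeLike : Prop :=
  ∃ (W : Type u) (T : SimpleGraph W), T.IsTree ∧
    ∃ ψ : V → W, IsQuasiIsometry (fun x y : V => (dist x y : ℝ))
      (fun a b : W => (T.dist a b : ℝ)) ψ

end

variable {V : Type u} [Quiver.{v} V] [Quiver.HasInvolutiveReverse V]

/-- The quotient by a family `P` of blocks: the simple undirected graph on the blocks in which two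
distinct blocks are adjacent if some edge of the graph joins them. -/
def quotientGraph (P : Set (Set V)) : SimpleGraph P where
  Adj S₁ S₂ := S₁ ≠ S₂ ∧ ∃ u₁ ∈ S₁.1, ∃ u₂ ∈ S₂.1, Nonempty (u₁ ⟶ u₂)
  symm := ⟨by
    rintro S₁ S₂ ⟨hne, u₁, h₁, u₂, h₂, ⟨e⟩⟩
    exact ⟨hne.symm, u₂, h₂, u₁, h₁, ⟨Quiver.reverse e⟩⟩⟩
  loopless := ⟨fun _ h => h.1 rfl⟩

/-- A partition of the vertex set whose quotient graph is a tree. -/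
def IsStrongTreeDecomposition (P : Set (Set V)) : Prop :=
  Setoid.IsPartition P ∧ (quotientGraph P).IsTree

end SymmGraph

/-!
All six conditions are compared with one property of the simple graph `G` underlying the symmetric
graph, the *bottleneck property* `SimpleGraph.IsBottleneck`: if `x` lies on a geodesic from `x₀` to
`y`, then every walk from `x₀` to `y` passes within `δ` of `x`. The separation condition about cones
and disks is this property in other words.

*Trees.* In a tree the bottleneck property holds with `δ = 0`. It yields a coarse median of any
three vertices (`IsBottleneck.exists_median`). Given a quasi-isometry from `G` to a tree and `x` on
a geodesic from `x₀` to `y`, the images of both halves of the geodesic and of any walk from `x₀` to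
`y` have to pass near the median of the images of `x₀`, `x`, `y`. As the halves form a geodesic,
this forces `x`, and then a vertex of the walk, to be mapped near the median
(`IsTree.exists_isBottleneck`).

*Gromov products.* A coarse median of `x`, `y`, `z` lies at distance about `(x|y)_z` from `z`, and
it lies on a geodesic from `x` to `y`; hence every path from `x` to `y` comes within `(x|y)_z + m`
of `z`. Applied to a concatenation of geodesics this is the inequality for sequences of Gromov
products; that inequality, applied to the vertices of a path, returns the bottleneck property.

*Polygons.* The sides of a geodesic polygon other than a given one form a path between the endpoints
of the given one, and conversely a path, cut into its edges, forms a geodesic polygon together with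
a geodesic between its endpoints. So thinness of polygons is the bottleneck property again.

*Decompositions.* Fix a basepoint `o` and cut each sphere about `o` into its intersections with the
components of the complement of the open ball of the same radius (`sphereSetoid`). The quotient
graph is always a tree, and the bound on the distance from `o` to a path bounds the diameters of
the blocks. Conversely the map to the tree of a strong tree decomposition with bounded blocks is a
quasi-isometry.
-/

namespace SimpleGraph

variable {V W : Type*} {G : SimpleGraph V} {T : SimpleGraph W}

/-! ### Bottlenecks in connected simple graphs -/

/-- Whenever `x` lies on a geodesic from `x₀` to `y`, every walk from `x₀` to `y` meets the ball of
radius `δ` about `x`. That `x` lies on a geodesic is expressed by equality in the triangle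
inequality. -/
def IsBottleneck (G : SimpleGraph V) (δ : ℕ) : Prop :=
  ∀ x x₀ y : V, G.dist x₀ y = G.dist x₀ x + G.dist x y →
    ∀ p : G.Walk x₀ y, ∃ w ∈ p.support, G.dist x w ≤ δ

lemma dist_add_dist_of_mem_support {x y w : V} (hG : G.Connected) {p : G.Walk x y}
    (hp : p.length = G.dist x y) (hw : w ∈ p.support) :
    G.dist x y = G.dist x w + G.dist w y := by
  classical
  have h := congrArg Walk.length (p.take_spec hw)
  rw [Walk.length_append] at h
  have h1 := dist_le (p.takeUntil w hw)
  have h2 := dist_le (p.dropUntil w hw)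
  have h3 : G.dist x y ≤ G.dist x w + G.dist w y := hG.dist_triangle
  omega

lemma exists_geodesic_through {x₀ x y : V} (hG : G.Connected)
    (h : G.dist x₀ y = G.dist x₀ x + G.dist x y) :
    ∃ p : G.Walk x₀ y, p.length = G.dist x₀ y ∧ x ∈ p.support := by
  obtain ⟨p, hp⟩ := hG.exists_walk_length_eq_dist x₀ x
  obtain ⟨q, hq⟩ := hG.exists_walk_length_eq_dist x y
  exact ⟨p.append q, by rw [Walk.length_append]; omega, by simp⟩

/-- In a tree, every walk visits every vertex of the geodesic between its endpoints. -/
lemma IsTree.isBottleneck_zero (hT : T.IsTree) : T.IsBottleneck 0 := by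
  classical
  intro x x₀ y h p
  obtain ⟨q, hq, hx⟩ := exists_geodesic_through hT.connected h
  have : p.bypass = q := (hT.existsUnique_path x₀ y).unique p.bypass_isPath
    (q.isPath_of_length_eq_dist hq)
  exact ⟨x, p.support_bypass_subset_support (this ▸ hx), by simp⟩

/-- A walk whose vertices all satisfy `A` or `B`, and which begins in `A` and ends in `B`, passes
from `A` to `B` in at most one step. -/
lemma Walk.exists_transition (A B : V → Prop) {x y : V} (p : G.Walk x y)
    (h : ∀ w ∈ p.support, A w ∨ B w) (hx : A x) (hy : B y) :
    ∃ w ∈ p.support, ∃ w' ∈ p.support, A w ∧ B w' ∧ G.dist w w' ≤ 1 := by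
  induction p with
  | nil => exact ⟨_, by simp, _, by simp, hx, hy, by simp⟩
  | @cons a b c e p ih =>
    rcases h b (by simp) with hb | hb
    · obtain ⟨w, hw, w', hw', h'⟩ := ih (fun w hw => h w (by simp [hw])) hb hy
      exact ⟨w, by simp [hw], w', by simp [hw'], h'⟩
    · exact ⟨a, by simp, b, by simp, hx, hb, (dist_eq_one_iff_adj.2 e).le⟩

/-- A coarse median: some vertex of a geodesic from `x` to `y` is close to a geodesic from `x` to
`z`, and a neighbouring one is close to a geodesic from `z` to `y`. -/
lemma IsBottleneck.exists_median {δ : ℕ} (hG : G.Connected) (h : G.IsBottleneck δ) (x y z : V) :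
    ∃ w w' a b : V, G.dist w w' ≤ 1 ∧ G.dist x y = G.dist x w + G.dist w y ∧
      G.dist x y = G.dist x w' + G.dist w' y ∧
      G.dist w a ≤ δ ∧ G.dist x z = G.dist x a + G.dist a z ∧
      G.dist w' b ≤ δ ∧ G.dist z y = G.dist z b + G.dist b y := by
  obtain ⟨g, hg⟩ := hG.exists_walk_length_eq_dist x y
  obtain ⟨p, hp⟩ := hG.exists_walk_length_eq_dist x z
  obtain ⟨q, hq⟩ := hG.exists_walk_length_eq_dist z y
  obtain ⟨w, hw, w', hw', ⟨a, ha, ha'⟩, ⟨b, hb, hb'⟩, h1⟩ := g.exists_transition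
    (fun w => ∃ a, G.dist w a ≤ δ ∧ G.dist x z = G.dist x a + G.dist a z)
    (fun w => ∃ b, G.dist w b ≤ δ ∧ G.dist z y = G.dist z b + G.dist b y)
    (by
      intro w hw
      obtain ⟨u, hu, hwu⟩ := h w x y (dist_add_dist_of_mem_support hG hg hw) (p.append q)
      rcases (Walk.mem_support_append_iff p q).1 hu with hu | hu
      · exact Or.inl ⟨u, hwu, dist_add_dist_of_mem_support hG hp hu⟩
      · exact Or.inr ⟨u, hwu, dist_add_dist_of_mem_support hG hq hu⟩)
    ⟨x, by simp⟩ ⟨y, by simp⟩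
  exact ⟨w, w', a, b, h1, dist_add_dist_of_mem_support hG hg hw,
    dist_add_dist_of_mem_support hG hg hw', ha, ha', hb, hb'⟩

/-- The bottleneck property bounds the distance from `z` to any walk from `x` to `y` by the Gromov
product `(x|y)_z` up to a constant: the walk passes close to a coarse median of `x`, `y`, `z`. -/
lemma IsBottleneck.exists_mem_support_dist_le {δ : ℕ} (hG : G.Connected) (h : G.IsBottleneck δ)
    {x y : V} (z : V) (p : G.Walk x y) :
    ∃ w ∈ p.support, 2 * G.dist z w + G.dist x y ≤
      G.dist z x + G.dist z y + 2 * (3 * δ + 1) := by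
  obtain ⟨w, w', a, b, h1, h2, h3, h4, h5, h6, h7⟩ := h.exists_median hG x y z
  obtain ⟨u, hu, hwu⟩ := h w x y h2 p
  refine ⟨u, hu, ?_⟩
  have t1 : G.dist z u ≤ G.dist z w + G.dist w u := hG.dist_triangle
  have t2 : G.dist z w ≤ G.dist z a + G.dist a w := hG.dist_triangle
  have t3 : G.dist x w ≤ G.dist x a + G.dist a w := hG.dist_triangle
  have t4 : G.dist z w' ≤ G.dist z b + G.dist b w' := hG.dist_triangle
  have t5 : G.dist w' y ≤ G.dist w' b + G.dist b y := hG.dist_triangle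
  have t6 : G.dist z w ≤ G.dist z w' + G.dist w' w := hG.dist_triangle
  have t7 : G.dist w y ≤ G.dist w w' + G.dist w' y := hG.dist_triangle
  rw [dist_comm (u := a) (v := w)] at *
  rw [dist_comm (u := b) (v := w')] at *
  rw [dist_comm (u := w') (v := w)] at *
  rw [dist_comm (u := x) (v := z)] at *
  rw [dist_comm (u := a) (v := z)] at *
  omega

/-! ### Quasi-isometries to trees -/

/-- The image of a walk under a map which moves adjacent vertices to vertices at distance at most
`L`, filled up by geodesics, is a walk in the `L`-neighbourhood of that image. -/
lemma Walk.exists_coarse_image {L : ℕ} (hT : T.Connected) (f : V → W)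
    (hf : ∀ a b, G.Adj a b → T.dist (f a) (f b) ≤ L) {x y : V} (p : G.Walk x y) :
    ∃ q : T.Walk (f x) (f y), ∀ u ∈ q.support, ∃ w ∈ p.support, T.dist u (f w) ≤ L := by
  induction p with
  | nil => exact ⟨.nil, by simp⟩
  | @cons a b c e p ih =>
    obtain ⟨q, hq⟩ := ih
    obtain ⟨g, hg⟩ := hT.exists_walk_length_eq_dist (f a) (f b)
    refine ⟨g.append q, fun u hu => ?_⟩
    rcases (Walk.mem_support_append_iff g q).1 hu with hu | hu
    · refine ⟨a, by simp, ?_⟩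
      have h1 := dist_add_dist_of_mem_support hT hg hu
      have h2 := hf a b e
      rw [dist_comm]
      omega
    · obtain ⟨w, hw, h⟩ := hq u hu
      exact ⟨w, by simp [hw], h⟩

/-- The coarse image in a tree of a walk in `G` comes close to every vertex of the geodesic between
the images of its endpoints. -/
lemma IsTree.exists_mem_support_dist_le {L : ℕ} (hT : T.IsTree) (f : V → W)
    (hf : ∀ a b, G.Adj a b → T.dist (f a) (f b) ≤ L) {x y : V} (p : G.Walk x y) {q : W}
    (hq : T.dist (f x) (f y) = T.dist (f x) q + T.dist q (f y)) :
    ∃ w ∈ p.support, T.dist q (f w) ≤ L := by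
  obtain ⟨r, hr⟩ := p.exists_coarse_image hT.connected f hf
  obtain ⟨u, hu, hqu⟩ := hT.isBottleneck_zero q _ _ hq r
  obtain rfl : q = u := hT.connected.dist_eq_zero_iff.1 (Nat.le_zero.1 hqu)
  exact hr q hu

/-- A graph quasi-isometric to a tree has bottlenecks. With `x` on a geodesic from `x₀` to `y`, the
images of the two halves of the geodesic and of any walk from `x₀` to `y` all pass close to the
median of the images of `x₀`, `x`, `y`; the points of the two halves which do so are close to each
other, and `x` lies between them. -/
lemma IsTree.exists_isBottleneck (hG : G.Connected) (hT : T.IsTree) (f : V → W) {k c K C : ℝ}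
    (hk : 0 < k) (hK : 0 < K)
    (h : ∀ x y : V, k * G.dist x y - c ≤ T.dist (f x) (f y) ∧
      (T.dist (f x) (f y) : ℝ) ≤ K * G.dist x y + C) :
    ∃ δ : ℕ, G.IsBottleneck δ := by
  set L : ℕ := ⌈K + C⌉₊ with hL
  have hf : ∀ a b, G.Adj a b → T.dist (f a) (f b) ≤ L := by
    intro a b hab
    have h1 := (h a b).2
    rw [dist_eq_one_iff_adj.2 hab, Nat.cast_one, mul_one] at h1
    exact_mod_cast h1.trans (Nat.le_ceil _)
  set D : ℝ := (2 * L + 1 + c) / k with hD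
  refine ⟨⌈(K * D + C + 2 * L + c) / k⌉₊, fun x x₀ y hx p => ?_⟩
  obtain ⟨g₁, hg₁⟩ := hG.exists_walk_length_eq_dist x₀ x
  obtain ⟨g₂, hg₂⟩ := hG.exists_walk_length_eq_dist x y
  obtain ⟨w, w', a, b, h1, h2, h3, h4, h5, h6, h7⟩ :=
    hT.isBottleneck_zero.exists_median hT.connected (f x₀) (f y) (f x)
  obtain rfl : w = a := hT.connected.dist_eq_zero_iff.1 (Nat.le_zero.1 h4)
  obtain rfl : w' = b := hT.connected.dist_eq_zero_iff.1 (Nat.le_zero.1 h6)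
  obtain ⟨a, ha, hwa⟩ := hT.exists_mem_support_dist_le f hf g₁ h5
  obtain ⟨b, hb, hwb⟩ := hT.exists_mem_support_dist_le f hf g₂ h7
  obtain ⟨u, hu, hwu⟩ := hT.exists_mem_support_dist_le f hf p h2
  refine ⟨u, hu, ?_⟩
  have e1 := dist_add_dist_of_mem_support hG hg₁ ha
  have e2 := dist_add_dist_of_mem_support hG hg₂ hb
  have hax : G.dist x a ≤ G.dist a b := by
    have t1 : G.dist x₀ y ≤ G.dist x₀ a + G.dist a y := hG.dist_triangle
    have t2 : G.dist a y ≤ G.dist a b + G.dist b y := hG.dist_triangle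
    rw [dist_comm (u := x) (v := a)]
    omega
  have hab : T.dist (f a) (f b) ≤ 2 * L + 1 := by
    have t1 : T.dist (f a) (f b) ≤ T.dist (f a) w + T.dist w (f b) := hT.connected.dist_triangle
    have t2 : T.dist w (f b) ≤ T.dist w w' + T.dist w' (f b) := hT.connected.dist_triangle
    rw [dist_comm (u := f a) (v := w)] at *
    omega
  have hxu : T.dist (f x) (f u) ≤ T.dist (f x) (f a) + 2 * L := by
    have t1 : T.dist (f x) (f u) ≤ T.dist (f x) (f a) + T.dist (f a) (f u) :=
      hT.connected.dist_triangle
    have t2 : T.dist (f a) (f u) ≤ T.dist (f a) w + T.dist w (f u) := hT.connected.dist_triangle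
    rw [dist_comm (u := f a) (v := w)] at *
    omega
  have hxaD : (G.dist x a : ℝ) ≤ D := by
    rw [hD, le_div_iff₀ hk]
    have r1 := (h a b).1
    have r2 : (T.dist (f a) (f b) : ℝ) ≤ 2 * L + 1 := by exact_mod_cast hab
    have r3 : (G.dist x a : ℝ) ≤ G.dist a b := by exact_mod_cast hax
    nlinarith
  have hfin : (G.dist x u : ℝ) ≤ (K * D + C + 2 * L + c) / k := by
    rw [le_div_iff₀ hk]
    have r1 := (h x u).1
    have r2 : (T.dist (f x) (f u) : ℝ) ≤ T.dist (f x) (f a) + 2 * L := by exact_mod_cast hxu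
    have r3 := (h x a).2
    have r4 := mul_le_mul_of_nonneg_left hxaD hK.le
    linarith
  exact_mod_cast hfin.trans (Nat.le_ceil _)

/-! ### Recognizing acyclic graphs by a level function -/

/-- A graph is acyclic if its vertices have levels such that adjacent ones have different levels and
every vertex has at most one neighbour of smaller level: on a cycle, the two neighbours of a vertex
of maximal level would violate this. -/
lemma isAcyclic_of_level (ℓ : V → ℕ) (hne : ∀ a b, G.Adj a b → ℓ a ≠ ℓ b)
    (huniq : ∀ a b c, G.Adj a b → G.Adj a c → ℓ b < ℓ a → ℓ c < ℓ a → b = c) :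
    G.IsAcyclic := by
  classical
  intro v p hp
  obtain ⟨m, hm, hmax⟩ := p.support.toFinset.exists_max_image ℓ ⟨v, by simp⟩
  have hm' : m ∈ p.support := by simpa using hm
  have hc := hp.rotate hm'
  have hle : ∀ w ∈ (p.rotate m hm').support, G.Adj m w → ℓ w < ℓ m := fun w hw hadj =>
    lt_of_le_of_ne (hmax w (by simpa using hw)) (hne _ _ hadj).symm
  have h1 := Walk.adj_snd hc.not_nil
  have h2 := (Walk.adj_penultimate hc.not_nil).symm
  exact hc.snd_ne_penultimate (huniq _ _ _ h1 h2 (hle _ (Walk.getVert_mem_support _ _) h1)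
    (hle _ (Walk.getVert_mem_support _ _) h2))

end SimpleGraph

namespace SymmGraph

open SimpleGraph (Walk)

/-! ### The underlying simple graph -/

/-- The simple graph underlying a symmetric graph: loops are dropped and the edges between two
distinct vertices are identified. -/
def underlyingGraph (V : Type u) [Quiver.{v} V] [Quiver.HasInvolutiveReverse V] :
    SimpleGraph V where
  Adj a b := a ≠ b ∧ Nonempty (a ⟶ b)
  symm := ⟨fun _ _ ⟨hne, ⟨e⟩⟩ => ⟨hne.symm, ⟨Quiver.reverse e⟩⟩⟩
  loopless := ⟨fun _ h => h.1 rfl⟩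

variable {V : Type u} [Quiver.{v} V] [Quiver.HasInvolutiveReverse V]

/-- Dropping the loops of a path gives a walk in the underlying simple graph. -/
lemma exists_walk_of_path {x y : V} (p : Quiver.Path x y) :
    ∃ w : (underlyingGraph V).Walk x y, w.length ≤ p.length ∧
      ∀ z, z ∈ w.support ↔ z ∈ p.vertices := by
  induction p with
  | nil => exact ⟨.nil, le_rfl, by simp⟩
  | @cons b c p e ih =>
    obtain ⟨w, hw, hs⟩ := ih
    by_cases hbc : b = c
    · subst hbc
      refine ⟨w, hw.trans (by simp), fun z => ?_⟩
      rw [Quiver.Path.mem_vertices_cons, hs]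
      exact ⟨Or.inl, fun h => h.elim id fun h => h ▸ p.end_mem_vertices⟩
    · have hadj : (underlyingGraph V).Adj b c := ⟨hbc, ⟨e⟩⟩
      refine ⟨w.concat hadj, by simpa using hw, fun z => ?_⟩
      rw [Quiver.Path.mem_vertices_cons, ← hs]
      simp [SimpleGraph.Walk.support_concat]

lemma exists_path_of_walk {x y : V} (w : (underlyingGraph V).Walk x y) :
    ∃ p : Quiver.Path x y, p.length = w.length ∧ ∀ z, z ∈ p.vertices ↔ z ∈ w.support := by
  induction w with
  | nil => exact ⟨.nil, rfl, by simp⟩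
  | @cons a b c h w ih =>
    obtain ⟨p, hp, hs⟩ := ih
    obtain ⟨e⟩ := h.2
    refine ⟨e.toPath.comp p, by simp [Quiver.Path.length_comp, hp, add_comm], fun z => ?_⟩
    rw [Quiver.Path.vertices_comp]
    simp [Quiver.Hom.toPath, hs]

lemma dist_eq (x y : V) : dist x y = (underlyingGraph V).dist x y := by
  by_cases hr : (underlyingGraph V).Reachable x y
  · obtain ⟨w, hw⟩ := hr.exists_walk_length_eq_dist
    obtain ⟨p, hp, -⟩ := exists_path_of_walk w
    refine le_antisymm (Nat.sInf_le ⟨p, hp.trans hw⟩) ?_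
    obtain ⟨q, hq⟩ : dist x y ∈ {n : ℕ | ∃ p : Quiver.Path x y, p.length = n} :=
      Nat.sInf_mem ⟨_, p, rfl⟩
    obtain ⟨w', hw', -⟩ := exists_walk_of_path q
    exact (SimpleGraph.dist_le w').trans (hw'.trans hq.le)
  · rw [SimpleGraph.dist_eq_zero_of_not_reachable hr]
    refine Nat.sInf_eq_zero.2 (Or.inr (Set.eq_empty_of_forall_notMem ?_))
    rintro n ⟨p, -⟩
    exact hr ⟨(exists_walk_of_path p).choose⟩

lemma exists_isGeodesic (hG : (underlyingGraph V).Connected) {a x b : V}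
    (h : (underlyingGraph V).dist a b = (underlyingGraph V).dist a x + (underlyingGraph V).dist x b) :
    ∃ s : Quiver.Path a b, IsGeodesic s ∧ x ∈ s.vertices := by
  obtain ⟨w, hw, hx⟩ := SimpleGraph.exists_geodesic_through hG h
  obtain ⟨s, hs, hv⟩ := exists_path_of_walk w
  exact ⟨s, by rw [IsGeodesic, hs, hw, dist_eq], (hv x).2 hx⟩

lemma IsGeodesic.dist_add_dist (hG : (underlyingGraph V).Connected) {a b x : V}
    {s : Quiver.Path a b} (hs : IsGeodesic s) (hx : x ∈ s.vertices) :
    (underlyingGraph V).dist a b =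
      (underlyingGraph V).dist a x + (underlyingGraph V).dist x b := by
  obtain ⟨w, hw, hv⟩ := exists_walk_of_path s
  refine SimpleGraph.dist_add_dist_of_mem_support hG (p := w) ?_ ((hv x).2 hx)
  exact le_antisymm (by rw [← dist_eq, ← hs]; exact hw) (SimpleGraph.dist_le w)

/-! ### Paths, disks and cones -/

lemma forall_not_exists_path_iff {δ : ℝ} (hδ : 0 ≤ δ) :
    (∀ x x₀ y : V, x₀ ∉ disk δ x → y ∈ cone x₀ x →
      ¬ ∃ p : Quiver.Path x₀ y, ∀ w ∈ p.vertices, w ∉ disk δ x) ↔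
    (underlyingGraph V).IsBottleneck ⌊δ⌋₊ := by
  simp only [disk, cone, Set.mem_ofPred_eq, dist_eq, ← Nat.le_floor_iff hδ]
  constructor
  · intro h x x₀ y hy p
    by_contra! hp
    obtain ⟨q, -, hq⟩ := exists_path_of_walk p
    exact h x x₀ y (not_le.2 (hp _ (by simp))) hy
      ⟨q, fun w hw => not_le.2 (hp w ((hq w).1 hw))⟩
  · rintro h x x₀ y - hy ⟨p, hp⟩
    obtain ⟨q, -, hq⟩ := exists_walk_of_path p
    obtain ⟨w, hw, hle⟩ := h x x₀ y hy q
    exact hp w ((hq w).1 hw) hle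

/-- For negative `δ` the disk is empty, and the trivial path avoids it. -/
lemma nonneg_of_forall_not_exists_path [Nonempty V] {δ : ℝ}
    (h : ∀ x x₀ y : V, x₀ ∉ disk δ x → y ∈ cone x₀ x →
      ¬ ∃ p : Quiver.Path x₀ y, ∀ w ∈ p.vertices, w ∉ disk δ x) : 0 ≤ δ := by
  by_contra! hδ
  obtain ⟨x⟩ := ‹Nonempty V›
  have hx : x ∉ disk δ x := fun hx => by
    have : (dist x x : ℝ) ≤ δ := hx
    have h0 : (0 : ℝ) ≤ dist x x := Nat.cast_nonneg _
    linarith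
  exact h x x x hx (by simp [cone, dist_eq]) ⟨.nil, by simpa using hx⟩

lemma exists_forall_not_exists_path_iff [Nonempty V] :
    (∃ δ : ℝ, ∀ x x₀ y : V, x₀ ∉ disk δ x → y ∈ cone x₀ x →
      ¬ ∃ p : Quiver.Path x₀ y, ∀ w ∈ p.vertices, w ∉ disk δ x) ↔
    ∃ n : ℕ, (underlyingGraph V).IsBottleneck n :=
  ⟨fun ⟨_, h⟩ => ⟨_, (forall_not_exists_path_iff (nonneg_of_forall_not_exists_path h)).1 h⟩,
    fun ⟨n, hn⟩ => ⟨n, (forall_not_exists_path_iff n.cast_nonneg).2 (by rwa [Nat.floor_natCast])⟩⟩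

lemma IsTreeLike.exists_isBottleneck (hG : (underlyingGraph V).Connected) (h : IsTreeLike V) :
    ∃ δ : ℕ, (underlyingGraph V).IsBottleneck δ := by
  obtain ⟨W, T, hT, ψ, ⟨k, c, K, C, hk, -, hK, -, h⟩, -⟩ := h
  simp only [dist_eq] at h
  exact hT.exists_isBottleneck hG ψ hk hK h

lemma distToPath_le_of_isBottleneck (hG : (underlyingGraph V).Connected) {δ : ℕ}
    (h : (underlyingGraph V).IsBottleneck δ) (x y z : V) (p : Quiver.Path x y) :
    (distToPath z p : ℝ) ≤
      1 / 2 * ((dist z x : ℝ) + (dist z y : ℝ) - (dist x y : ℝ)) + (3 * δ + 1) := by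
  obtain ⟨q, -, hq⟩ := exists_walk_of_path p
  obtain ⟨w, hw, hle⟩ := h.exists_mem_support_dist_le hG z q
  have h1 : distToPath z p ≤ dist z w := Nat.sInf_le ⟨w, (hq w).1 hw, rfl⟩
  simp only [dist_eq] at h1 ⊢
  rify at h1 hle
  linarith

lemma exists_mem_support_dist_le_of_distToPath {m : ℝ}
    (h : ∀ (x y z : V) (p : Quiver.Path x y), (distToPath z p : ℝ) ≤
      1 / 2 * ((dist z x : ℝ) + (dist z y : ℝ) - (dist x y : ℝ)) + m)
    {x y : V} (z : V) (p : (underlyingGraph V).Walk x y) :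
    ∃ w ∈ p.support, (dist z w : ℝ) ≤ gromovProduct x y z + m := by
  obtain ⟨q, -, hq⟩ := exists_path_of_walk p
  obtain ⟨w, hw, hd⟩ : distToPath z q ∈ {n : ℕ | ∃ w ∈ q.vertices, dist z w = n} :=
    Nat.sInf_mem ⟨_, x, q.start_mem_vertices, rfl⟩
  exact ⟨w, (hq w).1 hw, by rw [hd]; exact h x y z q⟩

/-! ### Gromov products along sequences -/

lemma gromovProduct_le_dist (hG : (underlyingGraph V).Connected) {a b w : V} (z : V)
    (h : (underlyingGraph V).dist a b =
      (underlyingGraph V).dist a w + (underlyingGraph V).dist w b) :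
    gromovProduct a b z ≤ dist z w := by
  have t1 : (underlyingGraph V).dist z a ≤
    (underlyingGraph V).dist z w + (underlyingGraph V).dist w a := hG.dist_triangle
  have t2 : (underlyingGraph V).dist z b ≤
    (underlyingGraph V).dist z w + (underlyingGraph V).dist w b := hG.dist_triangle
  rw [SimpleGraph.dist_comm (u := w) (v := a)] at t1
  simp only [gromovProduct, dist_eq]
  rify at h t1 t2
  linarith

/-- A path made of geodesics from `x i` to `x (i + 1)` stays at least as far from `z` as the least
Gromov product of consecutive terms. -/
lemma iInf_gromovProduct_le (hG : (underlyingGraph V).Connected) {m : ℝ}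
    (h : ∀ (x y z : V) (p : Quiver.Path x y), (distToPath z p : ℝ) ≤
      1 / 2 * ((dist z x : ℝ) + (dist z y : ℝ) - (dist x y : ℝ)) + m)
    {n : ℕ} (hn : 1 ≤ n) (x : Fin (n + 1) → V) (z : V) :
    (⨅ i : Fin n, gromovProduct (x i.castSucc) (x i.succ) z) - m ≤
      gromovProduct (x 0) (x (Fin.last n)) z := by
  set I := ⨅ i : Fin n, gromovProduct (x i.castSucc) (x i.succ) z with hI
  have hle : ∀ i : Fin n, I ≤ gromovProduct (x i.castSucc) (x i.succ) z := fun i =>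
    ciInf_le (Set.finite_range _).bddBelow i
  have hpath : ∀ k : Fin (n + 1), ∃ p : (underlyingGraph V).Walk (x 0) (x k),
      ∀ w ∈ p.support, I ≤ dist z w := by
    intro k
    induction k using Fin.induction with
    | zero =>
      refine ⟨.nil, fun w hw => ?_⟩
      obtain rfl : w = x 0 := by simpa using hw
      exact (hle ⟨0, hn⟩).trans (gromovProduct_le_dist hG z (by
        rw [show (⟨0, hn⟩ : Fin n).castSucc = 0 from rfl]; simp))
    | succ i ih =>
      obtain ⟨p, hp⟩ := ih
      obtain ⟨g, hg⟩ := hG.exists_walk_length_eq_dist (x i.castSucc) (x i.succ)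
      refine ⟨p.append g, fun w hw => ?_⟩
      rcases (Walk.mem_support_append_iff p g).1 hw with hw | hw
      · exact hp w hw
      · exact (hle i).trans (gromovProduct_le_dist hG z
          (SimpleGraph.dist_add_dist_of_mem_support hG hg hw))
  obtain ⟨p, hp⟩ := hpath (Fin.last n)
  obtain ⟨w, hw, hd⟩ := exists_mem_support_dist_le_of_distToPath h z p
  have := hp w hw
  linarith

/-- For `x` on a geodesic from `x₀` to `y` the Gromov product `(x₀|y)_x` vanishes, so along the
vertices of a walk some product of consecutive vertices is bounded; as these are adjacent, they are
close to `x`. -/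
lemma isBottleneck_of_iInf_gromovProduct_le (hG : (underlyingGraph V).Connected) {k : ℝ}
    (h : ∀ (n : ℕ) (_ : 1 ≤ n) (x : Fin (n + 1) → V) (z : V),
      (⨅ i : Fin n, gromovProduct (x i.castSucc) (x i.succ) z) - k ≤
        gromovProduct (x 0) (x (Fin.last n)) z) :
    (underlyingGraph V).IsBottleneck ⌈k + 1⌉₊ := by
  intro x x₀ y hy p
  rcases Nat.eq_zero_or_pos p.length with h0 | hpos
  · obtain rfl := Walk.eq_of_length_eq_zero h0
    rw [SimpleGraph.dist_self, eq_comm, Nat.add_eq_zero_iff] at hy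
    exact ⟨x₀, by simp, by rw [hy.2]; exact Nat.zero_le _⟩
  have hk := h p.length hpos (fun i => p.getVert i) x
  have : Nonempty (Fin p.length) := ⟨⟨0, hpos⟩⟩
  obtain ⟨i, hi⟩ := exists_eq_ciInf_of_finite
    (f := fun i : Fin p.length => gromovProduct (p.getVert i.castSucc) (p.getVert i.succ) x)
  rw [← hi] at hk
  have hadj := p.adj_getVert_succ i.2
  refine ⟨p.getVert i, p.getVert_mem_support _, ?_⟩
  have t : (underlyingGraph V).dist x (p.getVert i) ≤ (underlyingGraph V).dist x (p.getVert (i + 1))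
    + (underlyingGraph V).dist (p.getVert (i + 1)) (p.getVert i) := hG.dist_triangle
  have h1 := SimpleGraph.dist_eq_one_iff_adj.2 hadj
  rw [SimpleGraph.dist_comm (u := p.getVert (i + 1)), h1] at t
  simp only [gromovProduct, dist_eq, Fin.val_castSucc, Fin.val_succ, h1, Fin.val_zero, Fin.val_last,
    Walk.getVert_zero, Walk.getVert_length] at hk
  rw [SimpleGraph.dist_comm (u := x) (v := x₀)] at hk
  have hfin : ((underlyingGraph V).dist x (p.getVert i) : ℝ) ≤ k + 1 := by
    rify at hy t
    push_cast at hk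
    linarith
  exact_mod_cast hfin.trans (Nat.le_ceil _)

/-! ### Geodesic polygons -/

/-- A walk from `x₀` to `y`, cut into its edges, and a geodesic from `y` to `x₀` through `x` form a
geodesic polygon; thinness at `x` provides a vertex of the walk close to `x`. -/
lemma isBottleneck_of_isThin (hG : (underlyingGraph V).Connected) {δ : ℝ}
    (h : ∀ Q : GeodesicPolygon V, Q.IsThin δ) :
    (underlyingGraph V).IsBottleneck ⌈δ⌉₊ := by
  intro x x₀ y hy p
  rcases Nat.eq_zero_or_pos p.length with h0 | hpos
  · obtain rfl := Walk.eq_of_length_eq_zero h0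
    rw [SimpleGraph.dist_self, eq_comm, Nat.add_eq_zero_iff] at hy
    exact ⟨x₀, by simp, by rw [hy.2]; exact Nat.zero_le _⟩
  let corner : Fin (p.length + 1 + 1) → V :=
    Fin.cons y (fun i : Fin (p.length + 1) => p.getVert i)
  have hside : ∀ i : Fin (p.length + 1),
      ∃ s : Quiver.Path (corner i.castSucc) (corner i.succ), IsGeodesic s ∧
        (i = 0 → x ∈ s.vertices) ∧ (i ≠ 0 → ∀ z ∈ s.vertices, z ∈ p.support) := by
    intro i
    cases i using Fin.cases with
    | zero =>
      have h1 : corner (Fin.succ 0) = x₀ := by simp [corner]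
      have hy' : (underlyingGraph V).dist y x₀ =
          (underlyingGraph V).dist y x + (underlyingGraph V).dist x x₀ := by
        rw [SimpleGraph.dist_comm, hy, add_comm, SimpleGraph.dist_comm (u := x) (v := y),
          SimpleGraph.dist_comm (u := x) (v := x₀)]
      rw [h1]
      obtain ⟨s, hs, hx⟩ := exists_isGeodesic hG hy'
      exact ⟨s, hs, fun _ => hx, fun h => (h rfl).elim⟩
    | succ j =>
      have h1 : corner j.succ.castSucc = p.getVert j := rfl
      have h2 : corner j.succ.succ = p.getVert (j + 1) := rfl
      rw [h1, h2]
      obtain ⟨s, hs, -⟩ := exists_isGeodesic hG (a := p.getVert j) (x := p.getVert j)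
        (b := p.getVert (j + 1)) (by simp)
      refine ⟨s, hs, fun h => (Fin.succ_ne_zero j h).elim, fun _ z hz => ?_⟩
      -- the side is a single edge, so `z` is one of its endpoints
      have hd := hs.dist_add_dist hG hz
      rw [SimpleGraph.dist_eq_one_iff_adj.2 (p.adj_getVert_succ j.2)] at hd
      rcases Nat.eq_zero_or_pos ((underlyingGraph V).dist (p.getVert j) z) with h0 | h0
      · exact hG.dist_eq_zero_iff.1 h0 ▸ p.getVert_mem_support _
      · obtain rfl : z = p.getVert (j + 1) := hG.dist_eq_zero_iff.1 (by omega)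
        exact p.getVert_mem_support _
  choose side hgeo hx hsupp using hside
  let Q : GeodesicPolygon V :=
    { n := p.length + 1
      two_le := by omega
      corner := corner
      closed := by
        show p.getVert p.length = y
        simp
      side := side
      geodesic := hgeo }
  obtain ⟨j, hj, z, hz, hd⟩ := h Q (0 : Fin (p.length + 1)) x (hx 0 rfl)
  refine ⟨z, hsupp j hj z hz, ?_⟩
  rw [dist_eq] at hd
  exact_mod_cast hd.trans (Nat.le_ceil _)

/-- If a vertex `y` of one side were far from all the other sides, these would form a walk between
the endpoints of that side avoiding the ball about `y`. -/
lemma isThin_of_isBottleneck (hG : (underlyingGraph V).Connected) {δ : ℕ}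
    (h : (underlyingGraph V).IsBottleneck δ) (Q : GeodesicPolygon V) : Q.IsThin δ := by
  obtain ⟨n, hn, corner, closed, side, hgeo⟩ := Q
  obtain ⟨m, rfl⟩ : ∃ m, n = m + 2 := ⟨n - 2, by omega⟩
  show ∀ i : Fin (m + 2), ∀ y ∈ (side i).vertices,
    ∃ j : Fin (m + 2), j ≠ i ∧ ∃ z ∈ (side j).vertices, (dist y z : ℝ) ≤ δ
  intro i y hy
  by_contra! hfar
  simp only [dist_eq, Nat.cast_lt] at hfar
  let R : V → V → Prop := fun a b => ∃ p : (underlyingGraph V).Walk a b,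
    ∀ w ∈ p.support, δ < (underlyingGraph V).dist y w
  have hrefl : ∀ a, δ < (underlyingGraph V).dist y a → R a a := fun a ha =>
    ⟨.nil, by simpa using ha⟩
  have htrans : ∀ a b c, R a b → R b c → R a c := by
    rintro a b c ⟨p, hp⟩ ⟨q, hq⟩
    exact ⟨p.append q, fun w hw => ((Walk.mem_support_append_iff p q).1 hw).elim (hp w) (hq w)⟩
  have hstep : ∀ j, j ≠ i → R (corner j.castSucc) (corner j.succ) := by
    intro j hj
    obtain ⟨w, -, hw⟩ := exists_walk_of_path (side j)
    exact ⟨w, fun z hz => hfar j hj z ((hw z).1 hz)⟩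
  have hzero : δ < (underlyingGraph V).dist y (corner 0) := by
    by_cases hi : i = 0
    · have hl : Fin.last (m + 1) ≠ i := by rw [hi]; exact Fin.last_pos.ne'
      have := hfar _ hl _ (side _).end_mem_vertices
      rwa [Fin.succ_last, closed] at this
    · exact hfar 0 (Ne.symm hi) _ (side 0).start_mem_vertices
  have hsucc : δ < (underlyingGraph V).dist y (corner i.succ) := by
    by_cases hi : i = Fin.last (m + 1)
    · rw [hi, Fin.succ_last, closed]
      exact hzero
    · have hlt : (i : ℕ) + 1 < m + 2 := by
        have := Fin.val_lt_last hi
        omega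
      have hne : (⟨i + 1, hlt⟩ : Fin (m + 2)) ≠ i := fun h => by
        have := congrArg Fin.val h
        simp at this
      exact hfar ⟨i + 1, hlt⟩ hne _ (side _).start_mem_vertices
  have hpre : ∀ k : Fin (m + 2 + 1), k ≤ i.castSucc → R (corner 0) (corner k) := by
    intro k
    induction k using Fin.induction with
    | zero => exact fun _ => hrefl _ hzero
    | succ j ih =>
      intro hj
      have hlt : j < i := by
        rw [Fin.le_def] at hj
        rw [Fin.lt_def]
        simp only [Fin.val_succ, Fin.val_castSucc] at hj
        omega
      exact htrans _ _ _ (ih (Fin.castSucc_le_castSucc_iff.2 hlt.le)) (hstep j hlt.ne)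
  have hpost : ∀ k : Fin (m + 2 + 1), i.succ ≤ k → R (corner i.succ) (corner k) := by
    intro k
    induction k using Fin.induction with
    | zero => exact fun hk => (Fin.succ_ne_zero i (Fin.le_zero_iff.1 hk)).elim
    | succ j ih =>
      intro hj
      by_cases hij : i = j
      · subst hij
        exact hrefl _ hsucc
      · have hlt : i < j := lt_of_le_of_ne (Fin.succ_le_succ_iff.1 hj) hij
        refine htrans _ _ _ (ih ?_) (hstep j hlt.ne')
        rw [Fin.le_def]
        exact hlt
  have hR := hpost _ (Fin.le_last _)
  rw [closed] at hR
  obtain ⟨p, hp⟩ := htrans _ _ _ hR (hpre _ le_rfl)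
  have hd := (hgeo i).dist_add_dist hG hy
  obtain ⟨w, hw, hle⟩ := h y (corner i.succ) (corner i.castSucc) (by
    rw [SimpleGraph.dist_comm, hd, add_comm, SimpleGraph.dist_comm (v := y),
      SimpleGraph.dist_comm (u := y)]) p
  exact absurd (hp w hw) (not_lt.2 hle)

/-! ### Strong tree decompositions -/

lemma dist_le_of_walk_quotientGraph (hG : (underlyingGraph V).Connected) {P : Set (Set V)} {m : ℕ}
    (hm : ∀ S ∈ P, ∀ x ∈ S, ∀ y ∈ S, (underlyingGraph V).dist x y ≤ m) {S S' : P}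
    (w : (quotientGraph P).Walk S S') {x y : V} (hx : x ∈ S.1) (hy : y ∈ S'.1) :
    (underlyingGraph V).dist x y ≤ m + w.length * (m + 1) := by
  induction w generalizing x with
  | nil => simpa using hm _ (Subtype.property _) x hx y hy
  | @cons a b c h w ih =>
    obtain ⟨-, u₁, h₁, u₂, h₂, ⟨e⟩⟩ := id h
    have t1 : (underlyingGraph V).dist x y ≤
      (underlyingGraph V).dist x u₁ + (underlyingGraph V).dist u₁ y := hG.dist_triangle
    have t2 : (underlyingGraph V).dist u₁ y ≤
      (underlyingGraph V).dist u₁ u₂ + (underlyingGraph V).dist u₂ y := hG.dist_triangle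
    have t3 : (underlyingGraph V).dist u₁ u₂ ≤ 1 := by
      by_cases hu : u₁ = u₂
      · simp [hu]
      · exact (SimpleGraph.dist_eq_one_iff_adj.2 (show (underlyingGraph V).Adj _ _ from
          ⟨hu, ⟨e⟩⟩)).le
    have t4 := hm a.1 a.2 x hx u₁ h₁
    have t5 := ih h₂ hy
    rw [Walk.length_cons, Nat.succ_mul]
    omega

lemma exists_walk_quotientGraph {P : Set (Set V)} {f : V → P} (hf : ∀ x, x ∈ (f x).1) {x y : V}
    (p : (underlyingGraph V).Walk x y) :
    ∃ w : (quotientGraph P).Walk (f x) (f y), w.length ≤ p.length := by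
  induction p with
  | nil => exact ⟨.nil, le_rfl⟩
  | @cons a b c h p ih =>
    obtain ⟨w, hw⟩ := ih
    by_cases hab : f a = f b
    · rw [hab]
      exact ⟨w, hw.trans (by simp)⟩
    · exact ⟨.cons ⟨hab, a, hf a, b, hf b, h.2⟩ w, Nat.succ_le_succ hw⟩

/-- The map sending a vertex to its block is a quasi-isometry to the quotient tree. -/
lemma isTreeLike_of_isStrongTreeDecomposition (hG : (underlyingGraph V).Connected) {m : ℝ}
    {P : Set (Set V)} (hP : IsStrongTreeDecomposition P)
    (hm : ∀ S ∈ P, diam S ≤ ENNReal.ofReal m) : IsTreeLike V := by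
  have hm' : ∀ S ∈ P, ∀ x ∈ S, ∀ y ∈ S, (underlyingGraph V).dist x y ≤ ⌊m⌋₊ := by
    intro S hS x hx y hy
    have h1 : (dist x y : ℝ≥0∞) ≤ diam S :=
      le_iSup₂_of_le x hx (le_iSup₂_of_le (f := fun y _ => (dist x y : ℝ≥0∞)) y hy le_rfl)
    have h2 := h1.trans (hm S hS)
    rw [dist_eq] at h2
    rcases Nat.eq_zero_or_pos ((underlyingGraph V).dist x y) with h0 | h0
    · omega
    · rw [Nat.le_floor_iff' h0.ne']
      exact (ENNReal.natCast_le_ofReal h0.ne').1 h2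
  obtain ⟨⟨hne, hpart⟩, hT⟩ := hP
  choose f hf using fun x => (hpart x).exists
  refine ⟨P, quotientGraph P, hT, fun x => ⟨f x, (hf x).1⟩,
    ⟨1 / (⌊m⌋₊ + 1), 1, 1, 1, by positivity, one_pos, one_pos, one_pos, fun x y => ?_⟩, 0,
    fun S => ?_⟩
  · constructor
    · obtain ⟨w, hw⟩ := hT.connected.exists_walk_length_eq_dist ⟨f x, (hf x).1⟩ ⟨f y, (hf y).1⟩
      have h1 := dist_le_of_walk_quotientGraph hG hm' w (hf x).2 (hf y).2
      have h2 : (0 : ℝ) < ⌊m⌋₊ + 1 := by positivity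
      rw [hw] at h1
      beta_reduce
      rw [dist_eq, sub_le_iff_le_add, div_mul_eq_mul_div, one_mul, div_le_iff₀ h2]
      rify at h1
      linarith
    · obtain ⟨p, hp⟩ := hG.exists_walk_length_eq_dist x y
      obtain ⟨w, hw⟩ := exists_walk_quotientGraph (f := fun x => (⟨f x, (hf x).1⟩ : P))
        (fun x => (hf x).2) p
      have h1 := (SimpleGraph.dist_le w).trans (hw.trans hp.le)
      simp only [dist_eq]
      rify at h1
      linarith
  · obtain ⟨x, hx⟩ : S.1.Nonempty := Set.nonempty_iff_ne_empty.2 fun h => hne (h ▸ S.2)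
    have : (⟨f x, (hf x).1⟩ : P) = S := Subtype.ext ((hpart x).unique (hf x) ⟨S.2, hx⟩)
    exact ⟨x, by simp [this]⟩

/-- Two vertices are equivalent if they have the same distance `n` from the basepoint `o` and can be
joined by a walk staying at distance at least `n` from `o`. The classes are the intersections of the
sphere of radius `n` with the components of the complement of the open ball of radius `n`. -/
def sphereSetoid (o : V) : Setoid V where
  r x y := (underlyingGraph V).dist o x = (underlyingGraph V).dist o y ∧
    ∃ p : (underlyingGraph V).Walk x y,
      ∀ w ∈ p.support, (underlyingGraph V).dist o x ≤ (underlyingGraph V).dist o w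
  iseqv :=
    { refl := fun x => ⟨rfl, .nil, by simp⟩
      symm := fun ⟨h, p, hp⟩ => ⟨h.symm, p.reverse, fun w hw => h ▸ hp w (by simpa using hw)⟩
      trans := fun ⟨h, p, hp⟩ ⟨h', q, hq⟩ => ⟨h.trans h', p.append q, fun w hw =>
        ((Walk.mem_support_append_iff p q).1 hw).elim (hp w) fun hw => h ▸ hq w hw⟩ }

/-- The blocks of `sphereSetoid o` form a tree rooted at the block of `o`: adjacent vertices on one
sphere are equivalent, and any two vertices on the sphere of radius `n - 1` which are adjacent to
vertices of one block on the sphere of radius `n` are joined through that block, hence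
equivalent. -/
lemma isStrongTreeDecomposition_classes (hG : (underlyingGraph V).Connected) (o : V) :
    IsStrongTreeDecomposition (sphereSetoid o).classes := by
  refine ⟨Setoid.isPartition_classes _, ?_, ?_⟩
  · let f : V → (sphereSetoid o).classes := fun x => ⟨_, (sphereSetoid o).mem_classes x⟩
    have hf : ∀ x, x ∈ (f x).1 := fun x => (sphereSetoid o).refl' x
    have hsurj : ∀ S, ∃ x, f x = S := fun ⟨S, x, hx⟩ => ⟨x, Subtype.ext hx.symm⟩
    have : Nonempty (sphereSetoid o).classes := ⟨f o⟩
    refine ⟨fun S S' => ?_⟩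
    obtain ⟨x, rfl⟩ := hsurj S
    obtain ⟨y, rfl⟩ := hsurj S'
    obtain ⟨p⟩ := hG.preconnected x y
    exact ⟨(exists_walk_quotientGraph hf p).choose⟩
  · have hlev : ∀ S : (sphereSetoid o).classes, ∃ n, ∀ x ∈ S.1,
        (underlyingGraph V).dist o x = n := by
      rintro ⟨S, y, rfl⟩
      exact ⟨_, fun x hx => hx.1⟩
    have hrel : ∀ S : (sphereSetoid o).classes, ∀ x ∈ S.1, ∀ y ∈ S.1, sphereSetoid o x y :=
      fun S x hx y hy => (sphereSetoid o).rel_iff_exists_classes.2 ⟨S.1, S.2, hx, hy⟩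
    have heq : ∀ S S' : (sphereSetoid o).classes, ∀ x ∈ S.1, ∀ y ∈ S'.1,
        sphereSetoid o x y → S = S' := by
      intro S S' x hx y hy hxy
      obtain ⟨c, hc, hxc, hyc⟩ := (sphereSetoid o).rel_iff_exists_classes.1 hxy
      exact Subtype.ext ((Setoid.eq_of_mem_classes S.2 hx hc hxc).trans
        (Setoid.eq_of_mem_classes hc hyc S'.2 hy))
    choose ℓ hℓ using hlev
    have hadj : ∀ {S S' : (sphereSetoid o).classes}, (quotientGraph _).Adj S S' →
        ∃ a ∈ S.1, ∃ b ∈ S'.1, (underlyingGraph V).Adj a b := by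
      rintro S S' ⟨hne, a, ha, b, hb, he⟩
      refine ⟨a, ha, b, hb, fun hab => hne ?_, he⟩
      exact heq S S' a ha b hb (hab ▸ (sphereSetoid o).refl' a)
    refine SimpleGraph.isAcyclic_of_level ℓ ?_ ?_
    · intro S S' h hSS
      obtain ⟨a, ha, b, hb, hab⟩ := hadj h
      rw [← hℓ S a ha, ← hℓ S' b hb] at hSS
      exact h.1 (heq S S' a ha b hb ⟨hSS, hab.toWalk, by simp [hSS]⟩)
    · intro S S₁ S₂ h₁ h₂ hlt₁ hlt₂
      obtain ⟨a, ha, b, hb, hab⟩ := hadj h₁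
      obtain ⟨a', ha', b', hb', hab'⟩ := hadj h₂
      rw [← hℓ S a ha, ← hℓ _ b hb] at hlt₁
      rw [← hℓ S a' ha', ← hℓ _ b' hb'] at hlt₂
      obtain ⟨haa, p, hp⟩ := hrel S a ha a' ha'
      have t1 : (underlyingGraph V).dist o a ≤
        (underlyingGraph V).dist o b + (underlyingGraph V).dist b a := hG.dist_triangle
      have t2 : (underlyingGraph V).dist o a' ≤
        (underlyingGraph V).dist o b' + (underlyingGraph V).dist b' a' := hG.dist_triangle
      rw [SimpleGraph.dist_eq_one_iff_adj.2 hab.symm] at t1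
      rw [SimpleGraph.dist_eq_one_iff_adj.2 hab'.symm] at t2
      refine heq S₁ S₂ b hb b' hb' ⟨by omega, .cons hab.symm (p.concat hab'), fun w hw => ?_⟩
      simp only [Walk.support_cons, Walk.support_concat, List.mem_cons, List.mem_append,
        List.not_mem_nil, or_false] at hw
      rcases hw with rfl | hw | rfl
      · exact le_rfl
      · exact hlt₁.le.trans (hp w hw)
      · omega

lemma diam_le_of_mem_classes {m : ℝ}
    (h : ∀ (x y z : V) (p : Quiver.Path x y), (distToPath z p : ℝ) ≤
      1 / 2 * ((dist z x : ℝ) + (dist z y : ℝ) - (dist x y : ℝ)) + m)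
    (o : V) {S : Set V} (hS : S ∈ (sphereSetoid o).classes) :
    diam S ≤ ENNReal.ofReal (2 * m) := by
  refine iSup₂_le fun x hx => iSup₂_le fun y hy => ?_
  obtain ⟨hxy, p, hp⟩ := (sphereSetoid o).rel_iff_exists_classes.2 ⟨S, hS, hx, hy⟩
  obtain ⟨w, hw, hd⟩ := exists_mem_support_dist_le_of_distToPath h o p
  have h1 := hp w hw
  rw [← ENNReal.ofReal_natCast]
  refine ENNReal.ofReal_le_ofReal ?_
  simp only [gromovProduct, dist_eq] at hd ⊢
  rify at h1 hxy
  linarith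

end SymmGraph

theorem proposition3p1 {V : Type u} [Quiver.{v} V] [Quiver.HasInvolutiveReverse V]
    [Nonempty V] (hconn : ∀ x y : V, Nonempty (Quiver.Path x y)) :
    List.TFAE [
      SymmGraph.IsTreeLike V,
      ∃ m : ℝ, 1 < m ∧ ∃ P : Set (Set V), SymmGraph.IsStrongTreeDecomposition P ∧
        ∀ S ∈ P, SymmGraph.diam S ≤ ENNReal.ofReal m,
      ∃ m : ℝ, 1 < m ∧ ∀ (x y z : V) (p : Quiver.Path x y),
        (SymmGraph.distToPath z p : ℝ) ≤
          1 / 2 * ((SymmGraph.dist z x : ℝ) + (SymmGraph.dist z y : ℝ)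
            - (SymmGraph.dist x y : ℝ)) + m,
      ∃ k : ℝ, ∀ (n : ℕ) (_ : 1 ≤ n) (x : Fin (n + 1) → V) (z : V),
        (⨅ i : Fin n, SymmGraph.gromovProduct (x i.castSucc) (x i.succ) z) - k ≤
          SymmGraph.gromovProduct (x 0) (x (Fin.last n)) z,
      SymmGraph.IsPolygonHyperbolic V,
      ∃ δ : ℝ, ∀ x x₀ y : V, x₀ ∉ SymmGraph.disk δ x → y ∈ SymmGraph.cone x₀ x →
        ¬ ∃ p : Quiver.Path x₀ y, ∀ w ∈ p.vertices, w ∉ SymmGraph.disk δ x] := by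
  have hG : (SymmGraph.underlyingGraph V).Connected :=
    ⟨fun x y => ⟨(SymmGraph.exists_walk_of_path (hconn x y).some).choose⟩⟩
  tfae_have 1 → 6 := fun h =>
    SymmGraph.exists_forall_not_exists_path_iff.2 (h.exists_isBottleneck hG)
  tfae_have 6 → 3 := fun h => by
    obtain ⟨n, hn⟩ := SymmGraph.exists_forall_not_exists_path_iff.1 h
    refine ⟨3 * n + 2, by linarith [n.cast_nonneg (α := ℝ)], fun x y z p => ?_⟩
    linarith [SymmGraph.distToPath_le_of_isBottleneck hG hn x y z p]
  tfae_have 3 → 2 := by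
    rintro ⟨m, hm, h⟩
    exact ⟨2 * m, by linarith, _, SymmGraph.isStrongTreeDecomposition_classes hG
      (Classical.arbitrary V), fun S hS => SymmGraph.diam_le_of_mem_classes h _ hS⟩
  tfae_have 2 → 1 := by
    rintro ⟨m, -, P, hP, hm⟩
    exact SymmGraph.isTreeLike_of_isStrongTreeDecomposition hG hP hm
  tfae_have 3 → 4 := fun ⟨m, _, h⟩ =>
    ⟨m, fun _ hn x z => SymmGraph.iInf_gromovProduct_le hG h hn x z⟩
  tfae_have 4 → 6 := fun ⟨_, h⟩ =>
    SymmGraph.exists_forall_not_exists_path_iff.2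
      ⟨_, SymmGraph.isBottleneck_of_iInf_gromovProduct_le hG h⟩
  tfae_have 5 → 6 := fun ⟨_, _, h⟩ =>
    SymmGraph.exists_forall_not_exists_path_iff.2 ⟨_, SymmGraph.isBottleneck_of_isThin hG h⟩
  tfae_have 6 → 5 := fun h => by
    obtain ⟨n, hn⟩ := SymmGraph.exists_forall_not_exists_path_iff.1 h
    exact ⟨n, n.cast_nonneg, SymmGraph.isThin_of_isBottleneck hG hn⟩
  tfae_finish
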